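/- Let $n$ and $k$ be integers with $1\le k\le n-2$, and let $G$ be the simply connected simple algebraic group over $\mathbb{C}$ of type $D_n$ (so $n\ge 3$; type $D_3$ is $A_3$), with simple roots indexed by $I=\{1,\dots,n\}$, where $i$ and $i+1$ are joined for $1\le i\le n-2$ and $n-2$ and $n$ are joined in the Dynkin diagram. Let $e_i,f_i$ be the Chevalley generators, $x_i(t)=\exp(te_i)$, $y_i(t)=\exp(tf_i)$, let $\alpha_i^\vee:\mathbb{C}^\times\to G$ be the simple coroots, $T$ the maximal torus they generate, $U$ and $U^-$ the maximal unipotent subgroups generated by the $x_i(t)$ and by the $y_i(t)$, and $\Lambda_i$ the fundamental weights. Put $\overline{s}_i=x_i(-1)y_i(1)x_i(-1)$, and for a Weyl group element $w$ with a reduced expression $w=s_{i_1}\cdots s_{i_l}$ put $\overline{w}=\overline{s}_{i_1}\cdots\overline{s}_{i_l}$. Let $w_0$ be the longest element, with the reduced word $\mathbf{i}_0=(1,2,\dots,n)^{n-1}$. Let $\Delta_{\Lambda_k}$ be the regular function on $G$ with $\Delta_{\Lambda_k}(u^-tu^+)=\Lambda_k(t)$ for $u^-\in U^-$, $t\in T$,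 $u^+\in U$, and for $u,v$ in the Weyl group let $\Delta_{u\Lambda_k,v\Lambda_k}(g)=\Delta_{\Lambda_k}(\overline{u}^{\,-1}g\,\overline{v})$. For $c=(c^{(p)}_i)_{1\le p\le n-1,\,1\le i\le n}\in(\mathbb{C}^\times)^{n(n-1)}$ let $$\Theta^-_{\mathbf{i}_0}(c)=\prod_{p=1}^{n-1}\Big(\mathbf{y}_1(c^{(p)}_1)\,\mathbf{y}_2(c^{(p)}_2)\cdots\mathbf{y}_n(c^{(p)}_n)\Big),\qquad \mathbf{y}_i(a)=y_i(a)\,\alpha_i^\vee(a^{-1}),$$ the product over $p$ being taken in increasing order from left to right. Then for every such $c$ $$\Delta_{w_0s_k\Lambda_k,\Lambda_k}\big(\Theta^-_{\mathbf{i}_0}(c)\big)=\frac{1}{c^{(k)}_1}+\sum_{j=1}^{k-1}\frac{c^{(j)}_{k-j}}{c^{(j)}_{k-j+1}} .$$ -/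

import Mathlib

/-! Type `D_n`: the simply connected group, generalized minors of fundamental weights, and the
parametrization attached to the reduced word `(1, 2, …, n)^{n-1}` of the longest element. -/

namespace TypeD

/-- The index set `I = {1, 2, …, n}` of the simple roots. -/
abbrev Idx (n : ℕ) : Type := {i : ℕ // i ∈ Finset.Icc 1 n}

/-- Basis of the vector representation `V(Λ₁)`: `inl a` is `v_a`, `inr a` is `v_{\bar a}`. -/
abbrev VecBasis (n : ℕ) : Type := Idx n ⊕ Idx n

/-- Basis of the sum `V(Λ_{n-1}) ⊕ V(Λ_n)` of the two spin representations: sign vectors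
`(ε_1, …, ε_n)`, with `true` for `+` and `false` for `-` (the product of the signs separates the
two summands). -/
abbrev SpinBasis (n : ℕ) : Type := Idx n → Bool

/-- Basis of `V = V(Λ₁) ⊕ V(Λ_{n-1}) ⊕ V(Λ_n)`. Its weights generate the whole weight lattice. -/
abbrev Basis (n : ℕ) : Type := VecBasis n ⊕ SpinBasis n

/-- `vecArrow i b b'` says that `f_i` maps `b` to `b'` in the vector representation:
`f_i v_i = v_{i+1}` and `f_i v_{\bar{i+1}} = v_{\bar i}` for `i < n`, and
`f_n v_{n-1} = v_{\bar n}`, `f_n v_n = v_{\bar{n-1}}`. -/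
def vecArrow {n : ℕ} (i : Idx n) : VecBasis n → VecBasis n → Prop
  | .inl a, .inl a' => i.1 < n ∧ a.1 = i.1 ∧ a'.1 = i.1 + 1
  | .inr a, .inr a' => i.1 < n ∧ a.1 = i.1 + 1 ∧ a'.1 = i.1
  | .inl a, .inr a' => i.1 = n ∧ ((a.1 + 1 = n ∧ a'.1 = n) ∨ (a.1 = n ∧ a'.1 + 1 = n))
  | .inr _, .inl _ => False

/-- `spinArrow i ε ε'` says that `f_i` maps `ε` to `ε'` in the spin representations: for `i < n`
the signs `(ε_i, ε_{i+1}) = (+, -)` become `(-, +)`, and for `i = n` the signs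
`(ε_{n-1}, ε_n) = (+, +)` become `(-, -)`; all other signs are unchanged. -/
def spinArrow {n : ℕ} (i : Idx n) (ε ε' : SpinBasis n) : Prop :=
  ∃ j : Idx n,
    ((i.1 < n ∧ j.1 = i.1 + 1 ∧ ε i = true ∧ ε j = false ∧ ε' i = false ∧ ε' j = true) ∨
      (i.1 = n ∧ j.1 + 1 = n ∧ ε i = true ∧ ε j = true ∧ ε' i = false ∧ ε' j = false)) ∧
    ∀ l : Idx n, l ≠ i → l ≠ j → ε' l = ε l

/-- `arrow i b b'` says that `f_i` maps the basis vector `b` of `V` to `b'`. -/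
def arrow {n : ℕ} (i : Idx n) : Basis n → Basis n → Prop
  | .inl b, .inl b' => vecArrow i b b'
  | .inr ε, .inr ε' => spinArrow i ε ε'
  | _, _ => False

open Classical in
/-- The matrix of the Chevalley generator `f_i` on `V`. -/
noncomputable def f {n : ℕ} (i : Idx n) : Matrix (Basis n) (Basis n) ℂ :=
  Matrix.of fun b' b => if arrow i b b' then 1 else 0

open Classical in
/-- The matrix of the Chevalley generator `e_i` on `V`: it maps `b'` to `b` exactly when `f_i`
maps `b` to `b'`. -/
noncomputable def e {n : ℕ} (i : Idx n) : Matrix (Basis n) (Basis n) ℂ :=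
  Matrix.of fun b b' => if arrow i b b' then 1 else 0

theorem arrow_not_comp {n : ℕ} (i : Idx n) {b b' b'' : Basis n}
    (h : arrow i b b') (h' : arrow i b' b'') : False := by
  rcases b with (b | b) | b <;> rcases b' with (b' | b') | b' <;>
    rcases b'' with (b'' | b'') | b'' <;>
    simp only [arrow, vecArrow] at h h' <;> try omega
  obtain ⟨j, h, -⟩ := h
  obtain ⟨j', h', -⟩ := h'
  rcases h with h | h <;> rcases h' with h' | h' <;> simp_all

theorem e_mul_e {n : ℕ} (i : Idx n) : e i * e i = 0 := by
  ext b b''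
  rw [Matrix.mul_apply]
  refine Finset.sum_eq_zero fun b' _ => ?_
  by_cases h : arrow i b b'
  · have h' : ¬ arrow i b' b'' := fun h' => arrow_not_comp i h h'
    simp [e, h']
  · simp [e, h]

theorem f_mul_f {n : ℕ} (i : Idx n) : f i * f i = 0 := by
  ext b'' b
  rw [Matrix.mul_apply]
  refine Finset.sum_eq_zero fun b' _ => ?_
  by_cases h : arrow i b b'
  · have h' : ¬ arrow i b' b'' := fun h' => arrow_not_comp i h h'
    simp [f, h']
  · simp [f, h]

theorem isNilpotent_smul {n : ℕ} {A : Matrix (Basis n) (Basis n) ℂ} (hA : A * A = 0) (t : ℂ) :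
    IsNilpotent (t • A) :=
  ⟨2, by rw [pow_two, smul_mul_smul_comm, hA, smul_zero]⟩

/-- `exp (t A)` as an invertible matrix, for a matrix `A` with `A² = 0`. -/
noncomputable def expUnit {n : ℕ} (A : Matrix (Basis n) (Basis n) ℂ) (hA : A * A = 0) (t : ℂ) :
    GL (Basis n) ℂ where
  val := IsNilpotent.exp (t • A)
  inv := IsNilpotent.exp (-(t • A))
  val_inv := IsNilpotent.exp_mul_exp_neg_self (isNilpotent_smul hA t)
  inv_val := IsNilpotent.exp_neg_mul_exp_self (isNilpotent_smul hA t)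

/-- The simply connected simple algebraic group `G` over `ℂ` of type `D_n`: the group of
automorphisms of `V` generated by all `exp (t e_i)` and `exp (t f_i)`. -/
def G (n : ℕ) : Subgroup (GL (Basis n) ℂ) :=
  Subgroup.closure {g | ∃ (i : Idx n) (t : ℂ),
    g = expUnit (e i) (e_mul_e i) t ∨ g = expUnit (f i) (f_mul_f i) t}

/-- `x_i(t) = exp (t e_i) ∈ G`. -/
noncomputable def x {n : ℕ} (i : Idx n) (t : ℂ) : G n :=
  ⟨expUnit (e i) (e_mul_e i) t, Subgroup.subset_closure ⟨i, t, Or.inl rfl⟩⟩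

/-- `y_i(t) = exp (t f_i) ∈ G`. -/
noncomputable def y {n : ℕ} (i : Idx n) (t : ℂ) : G n :=
  ⟨expUnit (f i) (f_mul_f i) t, Subgroup.subset_closure ⟨i, t, Or.inr rfl⟩⟩

/-- `\bar s_i = x_i(-1) y_i(1) x_i(-1)`, the representative in `G` of the simple reflection. -/
noncomputable def sBar {n : ℕ} (i : Idx n) : G n := x i (-1) * y i 1 * x i (-1)

/-- The coroot subgroup `α_i^∨(c) = φ_i(diag(c, c⁻¹))`, where `φ_i : SL₂(ℂ) → G` sends the
elementary matrices to `x_i(t)`, `y_i(t)`. It is the image of the identity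
`diag(c, c⁻¹) = (1 c; 0 1) (1 0; -c⁻¹ 1) (1 c; 0 1) · (0 -1; 1 0)` in `SL₂(ℂ)`. -/
noncomputable def coroot {n : ℕ} (i : Idx n) (c : ℂˣ) : G n :=
  x i c * y i (-(c⁻¹ : ℂˣ)) * x i c * sBar i

/-- `𝐲_i(c) = y_i(c) α_i^∨(c⁻¹)`. -/
noncomputable def yBold {n : ℕ} (i : Idx n) (c : ℂˣ) : G n := y i c * coroot i c⁻¹

/-- The word `1, 2, …, n`. -/
def cycleWord (n : ℕ) : List (Idx n) :=
  List.ofFn fun i : Fin n => ⟨i.1 + 1, Finset.mem_Icc.mpr ⟨by omega, by omega⟩⟩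

/-- The representative `\bar w₀` in `G` of the longest element `w₀`, from its reduced word
`(1, 2, …, n)^{n-1}`. -/
noncomputable def w₀Bar (n : ℕ) : G n := ((cycleWord n).map sBar).prod ^ (n - 1)

/-- The representative of `w₀ s_k`. Since `ℓ(w₀ s_k) = ℓ(w₀) - 1`, appending `k` to a reduced word
of `w₀ s_k` gives a reduced word of `w₀`, so that `\bar w₀ = \overline{w₀ s_k} \bar s_k`. -/
noncomputable def w₀sBar {n : ℕ} (k : Idx n) : G n := w₀Bar n * (sBar k)⁻¹

/-- `Θ(c) = ∏_{p=1}^{n-1} 𝐲_1(c_1^{(p)}) 𝐲_2(c_2^{(p)}) ⋯ 𝐲_n(c_n^{(p)})`, the product being taken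
in this order; `c p i` is `c_i^{(p)}`. -/
noncomputable def Θ (n : ℕ) (c : ℕ → ℕ → ℂˣ) : G n :=
  (List.ofFn fun p : Fin (n - 1) =>
    ((cycleWord n).map fun i => yBold i (c (p.1 + 1) i.1)).prod).prod

/-- The principal minor `Δ_{Λ_k}` for `1 ≤ k ≤ n - 2`, where `V(Λ_k)` is generated by
`u = v_1 ∧ ⋯ ∧ v_k` in the exterior power of `V(Λ₁)`: the coefficient `⟨g u, u⟩` of `u` in `g u`,
which is a polynomial function of `g`. By `principalMinor_bigCell` it takes the value `Λ_k(t)` at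
`u⁻ t u⁺`. -/
noncomputable def principalMinor {n : ℕ} (k : Idx n) (g : G n) : ℂ :=
  Matrix.det (Matrix.of fun a b : {a : Idx n // a.1 ≤ k.1} =>
    (g : GL (Basis n) ℂ).1 (.inl (.inl a.1)) (.inl (.inl b.1)))

/-- The generalized minor `Δ_{uΛ_k, vΛ_k}(g) = Δ_{Λ_k}(\bar u⁻¹ g \bar v)`, given by the
representatives `\bar u`, `\bar v`. -/
noncomputable def generalizedMinor {n : ℕ} (k : Idx n) (uBar vBar g : G n) : ℂ :=
  principalMinor k (uBar⁻¹ * g * vBar)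

/-- The maximal unipotent subgroup `U`, generated by the `x_i(t)`. -/
def UPlus (n : ℕ) : Subgroup (G n) := Subgroup.closure {g | ∃ (i : Idx n) (t : ℂ), g = x i t}

/-- The maximal unipotent subgroup `U⁻`, generated by the `y_i(t)`. -/
def UMinus (n : ℕ) : Subgroup (G n) := Subgroup.closure {g | ∃ (i : Idx n) (t : ℂ), g = y i t}

theorem arrow_inj_right {n : ℕ} (i : Idx n) {b b' b'' : Basis n}
    (h : arrow i b b') (h' : arrow i b b'') : b' = b'' := by
  rcases b with (b | b) | b <;> rcases b' with (b' | b') | b' <;>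
    rcases b'' with (b'' | b'') | b'' <;>
    simp only [arrow, vecArrow] at h h' <;>
    first
    | (simp only [Sum.inl.injEq, Sum.inr.injEq, Subtype.ext_iff]; omega)
    | omega
    | skip
  obtain ⟨j, h, hl⟩ := h
  obtain ⟨j', h', hl'⟩ := h'
  have hj : j = j' := Subtype.ext (by omega)
  subst hj
  congr 1
  funext l
  by_cases h1 : l = i
  · subst h1; rcases h with h | h <;> rcases h' with h' | h' <;> simp_all
  by_cases h2 : l = j
  · subst h2
    rcases h with h | h <;> rcases h' with h' | h' <;> first | omega | simp_all
  rw [hl l h1 h2, hl' l h1 h2]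

theorem arrow_inj_left {n : ℕ} (i : Idx n) {b b' b'' : Basis n}
    (h : arrow i b b'') (h' : arrow i b' b'') : b = b' := by
  rcases b with (b | b) | b <;> rcases b' with (b' | b') | b' <;>
    rcases b'' with (b'' | b'') | b'' <;>
    simp only [arrow, vecArrow] at h h' <;>
    first
    | (simp only [Sum.inl.injEq, Sum.inr.injEq, Subtype.ext_iff]; omega)
    | omega
    | skip
  obtain ⟨j, h, hl⟩ := h
  obtain ⟨j', h', hl'⟩ := h'
  have hj : j = j' := Subtype.ext (by omega)
  subst hj
  congr 1
  funext l
  by_cases h1 : l = i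
  · subst h1; rcases h with h | h <;> rcases h' with h' | h' <;> simp_all
  by_cases h2 : l = j
  · subst h2
    rcases h with h | h <;> rcases h' with h' | h' <;> first | omega | simp_all
  rw [← hl l h1 h2, ← hl' l h1 h2]

/-- The matrix by which `g ∈ G` acts on `V`. -/
def mat {n : ℕ} (g : G n) : Matrix (Basis n) (Basis n) ℂ := (g : GL (Basis n) ℂ).1

theorem mat_mul {n : ℕ} (g h : G n) : mat (g * h) = mat g * mat h := rfl

theorem mat_one {n : ℕ} : mat (1 : G n) = 1 := rfl

theorem mat_x {n : ℕ} (i : Idx n) (t : ℂ) : mat (x i t) = 1 + t • e i := by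
  change IsNilpotent.exp (t • e i) = _
  rw [IsNilpotent.exp_eq_sum (k := 2)
    (by rw [pow_two, smul_mul_smul_comm, e_mul_e, smul_zero])]
  simp [Finset.sum_range_succ]

theorem mat_y {n : ℕ} (i : Idx n) (t : ℂ) : mat (y i t) = 1 + t • f i := by
  change IsNilpotent.exp (t • f i) = _
  rw [IsNilpotent.exp_eq_sum (k := 2)
    (by rw [pow_two, smul_mul_smul_comm, f_mul_f, smul_zero])]
  simp [Finset.sum_range_succ]

open Classical in
theorem e_mul_f {n : ℕ} (i : Idx n) :
    e i * f i = Matrix.diagonal fun b => if ∃ b', arrow i b b' then (1 : ℂ) else 0 := by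
  ext b b'
  rw [Matrix.mul_apply, Matrix.diagonal_apply]
  simp only [e, f, Matrix.of_apply]
  by_cases h : ∃ d, arrow i b d
  · obtain ⟨d, hd⟩ := h
    rw [Finset.sum_eq_single d]
    · have : arrow i b' d ↔ b = b' := ⟨fun h => arrow_inj_left i hd h, fun h => h ▸ hd⟩
      have h' : ∃ d, arrow i b d := ⟨d, hd⟩
      simp [hd, this, h']
    · intro d' _ hne
      have : ¬ arrow i b d' := fun h => hne (arrow_inj_right i h hd)
      simp [this]
    · simp
  · rw [if_neg h, ite_self]
    push Not at h
    simp [h]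

open Classical in
theorem f_mul_e {n : ℕ} (i : Idx n) :
    f i * e i = Matrix.diagonal fun b => if ∃ b', arrow i b' b then (1 : ℂ) else 0 := by
  ext b b'
  rw [Matrix.mul_apply, Matrix.diagonal_apply]
  simp only [e, f, Matrix.of_apply]
  by_cases h : ∃ d, arrow i d b
  · obtain ⟨d, hd⟩ := h
    rw [Finset.sum_eq_single d]
    · have : arrow i d b' ↔ b = b' := ⟨fun h => arrow_inj_right i hd h, fun h => h ▸ hd⟩
      have h' : ∃ d, arrow i d b := ⟨d, hd⟩
      simp [hd, this, h']
    · intro d' _ hne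
      have : ¬ arrow i d' b := fun h => hne (arrow_inj_left i h hd)
      simp [this]
    · simp
  · rw [if_neg h, ite_self]
    push Not at h
    simp [h]

theorem e_mul_f_mul_e {n : ℕ} (i : Idx n) : e i * f i * e i = e i := by
  classical
  rw [e_mul_f]
  ext b b'
  rw [Matrix.diagonal_mul]
  by_cases h : arrow i b b'
  · have h' : ∃ d, arrow i b d := ⟨b', h⟩
    simp [e, h, h']
  · simp [e, h]

theorem f_mul_e_mul_f {n : ℕ} (i : Idx n) : f i * e i * f i = f i := by
  classical
  rw [f_mul_e]
  ext b b'
  rw [Matrix.diagonal_mul]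
  by_cases h : arrow i b' b
  · have h' : ∃ d, arrow i d b := ⟨b', h⟩
    simp [f, h, h']
  · simp [f, h]

/-- `α_i^∨(c)` acts on `V` as `c^{h_i}`, where `h_i = e_i f_i - f_i e_i`. -/
theorem mat_coroot {n : ℕ} (i : Idx n) (c : ℂˣ) :
    mat (coroot i c) =
      1 + ((c : ℂ) - 1) • (e i * f i) + ((c : ℂ)⁻¹ - 1) • (f i * e i) := by
  have hc : (c : ℂ) ≠ 0 := c.ne_zero
  have key : ∀ s : ℂ, s ≠ 0 → (1 + s • e i) * (1 + (-s⁻¹) • f i) * (1 + s • e i) =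
      1 + s • e i - s⁻¹ • f i - e i * f i - f i * e i := by
    intro s hs
    simp only [mul_add, add_mul, one_mul, mul_one, smul_mul_assoc, mul_smul_comm, e_mul_e,
      e_mul_f_mul_e, smul_zero]
    match_scalars <;> field_simp <;> ring
  have h1 := key c hc
  have h2 := key (-1) (by norm_num)
  rw [inv_neg, inv_one, neg_neg] at h2
  simp only [coroot, sBar, mat_mul, mat_x, mat_y]
  rw [Units.val_inv_eq_inv_val, h1, h2]
  have a1 := e_mul_e i
  have a2 := f_mul_f i
  have a3 := e_mul_f_mul_e i
  have a4 := f_mul_e_mul_f i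
  have a5 : e i * (f i * e i) = e i := by rw [← mul_assoc, a3]
  have a6 : f i * (e i * f i) = f i := by rw [← mul_assoc, a4]
  have a7 : e i * (e i * f i) = 0 := by rw [← mul_assoc, a1, zero_mul]
  have a8 : f i * (f i * e i) = 0 := by rw [← mul_assoc, a2, zero_mul]
  have a9 : e i * f i * (e i * f i) = e i * f i := by rw [← mul_assoc, a3]
  have a10 : f i * e i * (f i * e i) = f i * e i := by rw [← mul_assoc, a4]
  have a11 : e i * f i * (f i * e i) = 0 := by rw [mul_assoc, a8, mul_zero]
  have a12 : f i * e i * (e i * f i) = 0 := by rw [mul_assoc, a7, mul_zero]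
  have a13 : e i * f i * f i = 0 := by rw [mul_assoc, a2, mul_zero]
  have a14 : f i * e i * e i = 0 := by rw [mul_assoc, a1, mul_zero]
  simp only [mul_add, add_mul, mul_sub, sub_mul, one_mul, mul_one, smul_mul_assoc,
    mul_smul_comm, a1, a2, a3, a4, a5, a6, a7, a8, a9, a10, a11, a12, a13, a14,
    smul_zero]
  module

/-- Index set of the span of `v_1, …, v_k`. -/
def IsHead {n : ℕ} (k : Idx n) : Basis n → Prop
  | .inl (.inl a) => a.1 ≤ k.1
  | _ => False

theorem head_sum {n : ℕ} (k : Idx n) (F : Basis n → ℂ) (hF : ∀ b, ¬ IsHead k b → F b = 0) :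
    ∑ b, F b = ∑ a : {a : Idx n // a.1 ≤ k.1}, F (.inl (.inl a.1)) := by
  classical
  symm
  refine Finset.sum_of_injOn (fun a => .inl (.inl a.1)) ?_ (by simp) ?_ (by simp)
  · intro a _ b _ h
    exact Subtype.ext (Sum.inl.inj (Sum.inl.inj h))
  · intro b _ hb
    apply hF
    intro h
    apply hb
    rcases b with (a | a) | a
    · exact ⟨⟨a, h⟩, by simp, rfl⟩
    · exact h.elim
    · exact h.elim

theorem principalMinor_mul_of_right {n : ℕ} (k : Idx n) (g h : G n)
    (hh : ∀ a b, ¬ IsHead k a → IsHead k b → mat h a b = 0) :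
    principalMinor k (g * h) = principalMinor k g * principalMinor k h := by
  unfold principalMinor
  rw [← Matrix.det_mul]
  congr 1
  ext a b
  change mat (g * h) _ _ = ∑ d : {a : Idx n // a.1 ≤ k.1}, mat g _ _ * mat h _ _
  rw [mat_mul, Matrix.mul_apply]
  exact head_sum k (fun d => mat g (.inl (.inl a.1)) d * mat h d (.inl (.inl b.1)))
    fun d hd => by rw [hh d (.inl (.inl b.1)) hd b.2, mul_zero]

theorem principalMinor_mul_of_left {n : ℕ} (k : Idx n) (g h : G n)
    (hg : ∀ a b, IsHead k a → ¬ IsHead k b → mat g a b = 0) :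
    principalMinor k (g * h) = principalMinor k g * principalMinor k h := by
  unfold principalMinor
  rw [← Matrix.det_mul]
  congr 1
  ext a b
  change mat (g * h) _ _ = ∑ d : {a : Idx n // a.1 ≤ k.1}, mat g _ _ * mat h _ _
  rw [mat_mul, Matrix.mul_apply]
  exact head_sum k (fun d => mat g (.inl (.inl a.1)) d * mat h d (.inl (.inl b.1)))
    fun d hd => by rw [hg (.inl (.inl a.1)) d a.2 hd, zero_mul]

theorem principalMinor_one {n : ℕ} (k : Idx n) : principalMinor k (1 : G n) = 1 := by
  classical
  unfold principalMinor
  rw [← Matrix.det_one (n := {a : Idx n // a.1 ≤ k.1})]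
  congr 1
  ext a b
  change (1 : Matrix (Basis n) (Basis n) ℂ) _ _ = _
  simp only [Matrix.one_apply, Sum.inl.injEq, Subtype.ext_iff]

theorem uPlus_head {n : ℕ} (k : Idx n) (u : G n) (hu : u ∈ UPlus n) :
    (∀ a b, ¬ IsHead k a → IsHead k b → mat u a b = 0) ∧ principalMinor k u = 1 := by
  classical
  have gen : ∀ (i : Idx n) (t : ℂ),
      (∀ a b, ¬ IsHead k a → IsHead k b → mat (x i t) a b = 0) ∧
        principalMinor k (x i t) = 1 := by
    intro i t
    constructor
    · intro a b ha hb
      have hab : a ≠ b := fun h => ha (h ▸ hb)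
      have : ¬ arrow i a b := by
        intro h
        rcases a with (a | a) | a <;> rcases b with (b | b) | b <;>
          simp only [IsHead, arrow, vecArrow] at *; omega
      simp [mat_x, e, hab, this]
    · unfold principalMinor
      rw [Matrix.det_of_isUpperTriangular]
      · refine Finset.prod_eq_one fun a _ => ?_
        change mat (x i t) _ _ = 1
        have : ¬ arrow i (.inl (.inl a.1)) (.inl (.inl a.1)) := by
          simp only [arrow, vecArrow]; omega
        simp [mat_x, e, this]
      · intro a b hab
        change mat (x i t) _ _ = 0
        have hab : b.1.1 < a.1.1 := hab
        have h1 : a.1 ≠ b.1 := fun h => by rw [h] at hab; omega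
        have : ¬ arrow i (.inl (.inl a.1)) (.inl (.inl b.1)) := by
          simp only [arrow, vecArrow]; omega
        simp [mat_x, e, this, h1]
  have mul : ∀ g h : G n, ((∀ a b, ¬ IsHead k a → IsHead k b → mat g a b = 0) ∧
      principalMinor k g = 1) → ((∀ a b, ¬ IsHead k a → IsHead k b → mat h a b = 0) ∧
      principalMinor k h = 1) → ((∀ a b, ¬ IsHead k a → IsHead k b → mat (g * h) a b = 0) ∧
      principalMinor k (g * h) = 1) := by
    rintro g h ⟨hg, hg1⟩ ⟨hh, hh1⟩
    refine ⟨fun a b ha hb => ?_, by rw [principalMinor_mul_of_right k g h hh, hg1, hh1, one_mul]⟩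
    rw [mat_mul, Matrix.mul_apply]
    refine Finset.sum_eq_zero fun d _ => ?_
    by_cases hd : IsHead k d
    · rw [hg a d ha hd, zero_mul]
    · rw [hh d b hd hb, mul_zero]
  have inv : ∀ (i : Idx n) (t : ℂ), (x i t)⁻¹ = x i (-t) := by
    intro i t
    rw [inv_eq_iff_mul_eq_one]
    apply Subtype.ext
    apply Units.ext
    change mat (x i t) * mat (x i (-t)) = 1
    rw [mat_x, mat_x]
    simp [mul_add, add_mul, e_mul_e]
  induction hu using Subgroup.closure_induction'' with
  | mem g hg => obtain ⟨i, t, rfl⟩ := hg; exact gen i t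
  | inv_mem g hg => obtain ⟨i, t, rfl⟩ := hg; rw [inv]; exact gen i (-t)
  | one =>
    refine ⟨fun a b ha hb => ?_, principalMinor_one k⟩
    have hab : a ≠ b := fun h => ha (h ▸ hb)
    simp [mat_one, hab]
  | mul g h _ _ hg hh => exact mul g h hg hh

theorem uMinus_head {n : ℕ} (k : Idx n) (u : G n) (hu : u ∈ UMinus n) :
    (∀ a b, IsHead k a → ¬ IsHead k b → mat u a b = 0) ∧ principalMinor k u = 1 := by
  classical
  have gen : ∀ (i : Idx n) (t : ℂ),
      (∀ a b, IsHead k a → ¬ IsHead k b → mat (y i t) a b = 0) ∧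
        principalMinor k (y i t) = 1 := by
    intro i t
    constructor
    · intro a b ha hb
      have hab : a ≠ b := fun h => hb (h ▸ ha)
      have : ¬ arrow i b a := by
        intro h
        rcases a with (a | a) | a <;> rcases b with (b | b) | b <;>
          simp only [IsHead, arrow, vecArrow] at *; omega
      simp [mat_y, f, hab, this]
    · unfold principalMinor
      rw [Matrix.det_of_isLowerTriangular]
      · refine Finset.prod_eq_one fun a _ => ?_
        change mat (y i t) _ _ = 1
        have : ¬ arrow i (.inl (.inl a.1)) (.inl (.inl a.1)) := by
          simp only [arrow, vecArrow]; omega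
        simp [mat_y, f, this]
      · intro a b hab
        change mat (y i t) _ _ = 0
        have hab : a.1.1 < b.1.1 := hab
        have h1 : a.1 ≠ b.1 := fun h => by rw [h] at hab; omega
        have : ¬ arrow i (.inl (.inl b.1)) (.inl (.inl a.1)) := by
          simp only [arrow, vecArrow]; omega
        simp [mat_y, f, this, h1]
  have inv : ∀ (i : Idx n) (t : ℂ), (y i t)⁻¹ = y i (-t) := by
    intro i t
    rw [inv_eq_iff_mul_eq_one]
    apply Subtype.ext
    apply Units.ext
    change mat (y i t) * mat (y i (-t)) = 1
    rw [mat_y, mat_y]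
    simp [mul_add, add_mul, f_mul_f]
  induction hu using Subgroup.closure_induction'' with
  | mem g hg => obtain ⟨i, t, rfl⟩ := hg; exact gen i t
  | inv_mem g hg => obtain ⟨i, t, rfl⟩ := hg; rw [inv]; exact gen i (-t)
  | one =>
    refine ⟨fun a b ha hb => ?_, principalMinor_one k⟩
    have hab : a ≠ b := fun h => hb (h ▸ ha)
    simp [mat_one, hab]
  | mul g h _ _ hg hh =>
    refine ⟨fun a b ha hb => ?_, by
      rw [principalMinor_mul_of_left k g h hg.1, hg.2, hh.2, one_mul]⟩
    rw [mat_mul, Matrix.mul_apply]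
    refine Finset.sum_eq_zero fun d _ => ?_
    by_cases hd : IsHead k d
    · rw [hh.1 d b hd hb, mul_zero]
    · rw [hg.1 a d ha hd, zero_mul]

theorem coroot_head {n : ℕ} (k : Idx n) (hk : k.1 ≤ n - 2) (i : Idx n) (c : ℂˣ) :
    (∀ a b, ¬ IsHead k a → IsHead k b → mat (coroot i c) a b = 0) ∧
      principalMinor k (coroot i c) = if i = k then (c : ℂ) else 1 := by
  classical
  obtain ⟨i, hi⟩ := i
  obtain ⟨k, hk'⟩ := k
  have hi' := Finset.mem_Icc.mp hi
  have hkk := Finset.mem_Icc.mp hk'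
  simp only at hk
  constructor
  · intro a b ha hb
    have hab : a ≠ b := fun h => ha (h ▸ hb)
    rw [mat_coroot, e_mul_f, f_mul_e]
    simp [hab]
  · have hdiag : (Matrix.of fun a b : {a : Idx n // a.1 ≤ k} =>
        mat (coroot ⟨i, hi⟩ c) (.inl (.inl a.1)) (.inl (.inl b.1))) =
        Matrix.diagonal fun a => (if a.1.1 = i then (c : ℂ) else 1) *
          (if a.1.1 = i + 1 then (c : ℂ)⁻¹ else 1) := by
      ext a b
      obtain ⟨⟨a, ha'⟩, ha⟩ := a
      simp only at ha
      have haa := Finset.mem_Icc.mp ha'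
      rw [Matrix.of_apply, mat_coroot, e_mul_f, f_mul_e, Matrix.diagonal_apply]
      by_cases hab : (⟨⟨a, ha'⟩, ha⟩ : {a : Idx n // a.1 ≤ k}) = b
      · subst hab
        have h1 : (∃ d, arrow (⟨i, hi⟩ : Idx n) (.inl (.inl ⟨a, ha'⟩)) d) ↔ a = i := by
          constructor
          · rintro ⟨(d | d) | d, h⟩ <;> simp only [arrow, vecArrow] at h <;> omega
          · rintro rfl
            exact ⟨.inl (.inl ⟨a + 1, Finset.mem_Icc.mpr ⟨by omega, by omega⟩⟩),
              by simp only [arrow, vecArrow, and_true]; omega⟩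
        have h2 : (∃ d, arrow (⟨i, hi⟩ : Idx n) d (.inl (.inl ⟨a, ha'⟩))) ↔ a = i + 1 := by
          constructor
          · rintro ⟨(d | d) | d, h⟩ <;> simp only [arrow, vecArrow] at h <;> omega
          · rintro rfl
            exact ⟨.inl (.inl ⟨i, hi⟩), by simp only [arrow, vecArrow, and_true]; omega⟩
        simp only [Matrix.add_apply, Matrix.one_apply_eq, Matrix.smul_apply,
          Matrix.diagonal_apply_eq, h1, h2, if_true]
        by_cases h3 : a = i
        · have h4 : a ≠ i + 1 := by omega
          simp [h3]
        · simp [h3]; split_ifs <;> simp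
      · have hab' : (⟨a, ha'⟩ : Idx n) ≠ b.1 := fun h => hab (Subtype.ext h)
        simp [hab, hab']
    change Matrix.det (Matrix.of fun a b : {a : Idx n // a.1 ≤ k} =>
        mat (coroot ⟨i, hi⟩ c) (.inl (.inl a.1)) (.inl (.inl b.1))) = _
    rw [hdiag, Matrix.det_diagonal, Finset.prod_mul_distrib]
    have hprod : ∀ (m : ℕ) (z : ℂ), 1 ≤ m →
        ∏ a : {a : Idx n // a.1 ≤ k}, (if a.1.1 = m then z else 1) =
          if m ≤ k then z else 1 := by
      intro m z hm
      by_cases h : m ≤ k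
      · rw [if_pos h, Finset.prod_eq_single
          (⟨⟨m, Finset.mem_Icc.mpr ⟨hm, by omega⟩⟩, h⟩ : {a : Idx n // a.1 ≤ k})]
        · simp
        · intro b _ hb
          rw [if_neg]
          intro h'
          exact hb (Subtype.ext (Subtype.ext h'))
        · simp
      · rw [if_neg h]
        refine Finset.prod_eq_one fun a _ => if_neg ?_
        have := a.2
        omega
    rw [hprod i c (by omega), hprod (i + 1) _ (by omega)]
    have hik : ((⟨i, hi⟩ : Idx n) = ⟨k, hk'⟩) ↔ i = k := by simp
    simp only [hik]
    rcases lt_trichotomy i k with h | h | h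
    · have h1 : i ≤ k := by omega
      have h2 : i + 1 ≤ k := by omega
      simp [h1, h2, h.ne]
    · subst h; simp
    · have h1 : ¬ i ≤ k := by omega
      have h2 : ¬ i + 1 ≤ k := by omega
      simp [h1, h2, h.ne']

/-- The defining property of the principal minor: `Δ_{Λ_k}(u⁻ t u⁺) = Λ_k(t)` for `u⁻ ∈ U⁻`,
`u⁺ ∈ U` and `t = ∏_i α_i^∨(c_i)` in the maximal torus, for which `Λ_k(t) = c_k`. -/
theorem principalMinor_bigCell {n : ℕ} (k : Idx n) (hk : k.1 ≤ n - 2) (c : Idx n → ℂˣ)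
    (u v : G n) (hu : u ∈ UMinus n) (hv : v ∈ UPlus n) :
    principalMinor k (u * ((cycleWord n).map fun i => coroot i (c i)).prod * v) = c k := by
  classical
  have hl : ∀ l : List (Idx n), principalMinor k (l.map fun i => coroot i (c i)).prod =
      (l.map fun i => if i = k then (c i : ℂ) else 1).prod := by
    intro l
    induction l using List.reverseRecOn with
    | nil => simpa using principalMinor_one k
    | append_singleton l i ih =>
      simp only [List.map_append, List.prod_append, List.map_cons, List.map_nil, List.prod_cons,
        List.prod_nil, mul_one]
      rw [principalMinor_mul_of_right k _ _ (coroot_head k hk i (c i)).1, ih,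
        (coroot_head k hk i (c i)).2]
  rw [principalMinor_mul_of_right k _ _ (uPlus_head k v hv).1, (uPlus_head k v hv).2, mul_one,
    principalMinor_mul_of_left k _ _ (uMinus_head k u hu).1, (uMinus_head k u hu).2, one_mul, hl,
    cycleWord, List.map_ofFn, List.prod_ofFn]
  have hkk := Finset.mem_Icc.mp k.2
  rw [Finset.prod_eq_single (⟨k.1 - 1, by omega⟩ : Fin n)]
  · have : (⟨k.1 - 1 + 1, Finset.mem_Icc.mpr ⟨by omega, by omega⟩⟩ : Idx n) = k :=
      Subtype.ext (by simp only; omega)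
    simp [this]
  · intro b _ hb
    simp only [Function.comp]
    rw [if_neg]
    intro h
    apply hb
    apply Fin.ext
    have := congrArg Subtype.val h
    simp only at this ⊢
    omega
  · simp

end TypeD

/-!
The rows `1, …, k` of `\bar s_k \bar w₀⁻¹ Θ` are, up to signs, the rows
`\bar 1, …, \overline{k - 1}, \overline{k + 1}` of `Θ`. Let `T_p` be the product of the cycles
`p, …, n - 1` of `Θ`, and let `w_a` be the coordinate row of `\bar a`. Normalised by `c^{(p)}_{a-1}`
(by `1` for `a = 1`), each `w_a` with `a ≤ n - 1` pairs to `1` with the first column `T_p v_p`, and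
the difference of the normalised `w_a` and `w_{a+1}`, multiplied by the `p`-th cycle, is
`c^{(p)}_a w_a`. Hence clearing the first column of the minor of `T_p` with rows
`\bar 1, …, \bar m, \overline{a + 1}` leaves a minor of `T_{p+1}` of size one less with rows
proportional to `\bar 1, …, \overline{m - 1}`, and last row a combination of the `w_t` with
`m ≤ t ≤ a`. For `a = m` this makes the minor equal to `1` by induction; for `a = m + 1` the two
values of `t` give the two terms of a recursion that unrolls to the stated sum.
-/

namespace TypeD

open Matrix

theorem mat_yBold {n : ℕ} (i : Idx n) (c : ℂˣ) :
    mat (yBold i c) = 1 + ((c : ℂ)⁻¹ - 1) • (e i * f i) + ((c : ℂ) - 1) • (f i * e i) + f i := by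
  have f_mul_e_f : f i * (e i * f i) = f i := by rw [← mul_assoc, f_mul_e_mul_f]
  have f_mul_f_e : f i * (f i * e i) = 0 := by rw [← mul_assoc, f_mul_f, zero_mul]
  rw [yBold, mat_mul, mat_y, mat_coroot, Units.val_inv_eq_inv_val, inv_inv]
  simp only [mul_add, add_mul, one_mul, mul_one, smul_mul_assoc, mul_smul_comm, f_mul_e_f,
    f_mul_f_e, smul_zero]
  match_scalars <;> field_simp
  ring

theorem mat_sBar {n : ℕ} (i : Idx n) :
    mat (sBar i) = 1 - e i + f i - e i * f i - f i * e i := by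
  rw [sBar, mat_mul, mat_mul, mat_x, mat_y]
  simp only [mul_add, add_mul, one_mul, mul_one, smul_mul_assoc, mul_smul_comm, e_mul_e,
    e_mul_f_mul_e, smul_zero]
  module

theorem f_transpose {n : ℕ} (i : Idx n) : (f i)ᵀ = e i := rfl

theorem e_transpose {n : ℕ} (i : Idx n) : (e i)ᵀ = f i := rfl

theorem f_mulVec {n : ℕ} (i : Idx n) (u : Basis n → ℂ) : f i *ᵥ u = u ᵥ* e i := by
  rw [← f_transpose, vecMul_transpose]

theorem e_mulVec {n : ℕ} (i : Idx n) (u : Basis n → ℂ) : e i *ᵥ u = u ᵥ* f i := by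
  rw [← e_transpose, vecMul_transpose]

/-- The pair `p, q` spans a copy of the two-dimensional representation of the `i`-th `SL₂`, with
`f_i p = q` and `e_i q = p`. As `e_i` is the transpose of `f_i`, it is enough to say how `e_i` and
`f_i` act on `p` and `q` as row vectors. -/
structure IsDoublet {n : ℕ} (i : Idx n) (p q : Basis n → ℂ) : Prop where
  snd_vecMul_f : q ᵥ* f i = p
  fst_vecMul_f : p ᵥ* f i = 0
  fst_vecMul_e : p ᵥ* e i = q
  snd_vecMul_e : q ᵥ* e i = 0

/-- The vector `u` is invariant under the `i`-th `SL₂`. -/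
structure IsInvariant {n : ℕ} (i : Idx n) (u : Basis n → ℂ) : Prop where
  vecMul_f : u ᵥ* f i = 0
  vecMul_e : u ᵥ* e i = 0

section SL2

variable {n : ℕ} {i : Idx n}

theorem isDoublet_single {b b' : Basis n} (h : arrow i b b') :
    IsDoublet i (Pi.single b 1) (Pi.single b' 1) := by
  have source_iff (d : Basis n) : arrow i d b' ↔ d = b :=
    ⟨fun hd => arrow_inj_left i hd h, fun hd => hd ▸ h⟩
  have target_iff (d : Basis n) : arrow i b d ↔ d = b' :=
    ⟨fun hd => arrow_inj_right i hd h, fun hd => hd ▸ h⟩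
  have not_to_source (d : Basis n) : ¬ arrow i d b := fun hd => arrow_not_comp i hd h
  have not_from_target (d : Basis n) : ¬ arrow i b' d := fun hd => arrow_not_comp i h hd
  constructor <;> ext d <;> rw [single_one_vecMul] <;>
    simp [f, e, Pi.single_apply, source_iff, target_iff, not_to_source, not_from_target]

theorem isInvariant_single {b : Basis n} (h : ∀ d, ¬ arrow i b d ∧ ¬ arrow i d b) :
    IsInvariant i (Pi.single b 1) := by
  constructor <;> ext d <;> rw [single_one_vecMul] <;> simp [f, e, h]

variable {p q u : Basis n → ℂ}

theorem IsDoublet.fst_vecMul_yBold (h : IsDoublet i p q) (c : ℂˣ) :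
    p ᵥ* mat (yBold i c) = (c : ℂ)⁻¹ • p := by
  simp only [mat_yBold, vecMul_add, vecMul_one, vecMul_smul, ← vecMul_vecMul, h.fst_vecMul_e,
    h.snd_vecMul_f, h.fst_vecMul_f, zero_vecMul]
  module

theorem IsDoublet.snd_vecMul_yBold (h : IsDoublet i p q) (c : ℂˣ) :
    q ᵥ* mat (yBold i c) = (c : ℂ) • q + p := by
  simp only [mat_yBold, vecMul_add, vecMul_one, vecMul_smul, ← vecMul_vecMul, h.fst_vecMul_e,
    h.snd_vecMul_f, h.snd_vecMul_e, zero_vecMul]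
  module

theorem IsDoublet.yBold_mulVec_fst (h : IsDoublet i p q) (c : ℂˣ) :
    mat (yBold i c) *ᵥ p = (c : ℂ)⁻¹ • p + q := by
  simp only [mat_yBold, add_mulVec, one_mulVec, smul_mulVec, ← mulVec_mulVec, f_mulVec, e_mulVec,
    h.fst_vecMul_e, h.snd_vecMul_f, h.fst_vecMul_f, zero_vecMul]
  module

theorem IsDoublet.yBold_mulVec_snd (h : IsDoublet i p q) (c : ℂˣ) :
    mat (yBold i c) *ᵥ q = (c : ℂ) • q := by
  simp only [mat_yBold, add_mulVec, one_mulVec, smul_mulVec, ← mulVec_mulVec, f_mulVec, e_mulVec,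
    h.fst_vecMul_e, h.snd_vecMul_f, h.snd_vecMul_e, zero_vecMul]
  module

theorem IsDoublet.fst_vecMul_sBar (h : IsDoublet i p q) : p ᵥ* mat (sBar i) = -q := by
  simp only [mat_sBar, vecMul_add, vecMul_sub, vecMul_one, ← vecMul_vecMul, h.fst_vecMul_e,
    h.snd_vecMul_f, h.fst_vecMul_f, zero_vecMul]
  module

theorem IsDoublet.snd_vecMul_sBar (h : IsDoublet i p q) : q ᵥ* mat (sBar i) = p := by
  simp only [mat_sBar, vecMul_add, vecMul_sub, vecMul_one, ← vecMul_vecMul, h.fst_vecMul_e,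
    h.snd_vecMul_f, h.snd_vecMul_e, zero_vecMul]
  module

theorem IsInvariant.vecMul_yBold (h : IsInvariant i u) (c : ℂˣ) : u ᵥ* mat (yBold i c) = u := by
  simp [mat_yBold, vecMul_add, vecMul_smul, ← vecMul_vecMul, h.vecMul_f, h.vecMul_e]

theorem IsInvariant.yBold_mulVec (h : IsInvariant i u) (c : ℂˣ) : mat (yBold i c) *ᵥ u = u := by
  simp [mat_yBold, add_mulVec, smul_mulVec, ← mulVec_mulVec, f_mulVec, e_mulVec, h.vecMul_f,
    h.vecMul_e]

theorem IsInvariant.vecMul_sBar (h : IsInvariant i u) : u ᵥ* mat (sBar i) = u := by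
  simp [mat_sBar, vecMul_add, vecMul_sub, ← vecMul_vecMul, h.vecMul_f, h.vecMul_e]

end SL2

theorem Idx.one_le {n : ℕ} (i : Idx n) : 1 ≤ i.1 := (Finset.mem_Icc.mp i.2).1

theorem Idx.le {n : ℕ} (i : Idx n) : i.1 ≤ n := (Finset.mem_Icc.mp i.2).2

/-- The coordinate vector of `v_a`, and zero when `a ∉ {1, …, n}`. -/
def vVec (n a : ℕ) : Basis n → ℂ
  | .inl (.inl d) => if d.1 = a then 1 else 0
  | _ => 0

/-- The coordinate vector of `v_{\bar a}`, and zero when `a ∉ {1, …, n}`. -/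
def wVec (n a : ℕ) : Basis n → ℂ
  | .inl (.inr d) => if d.1 = a then 1 else 0
  | _ => 0

section CoordinateVectors

variable {n : ℕ}

theorem vVec_eq_single (a : Idx n) : vVec n a.1 = Pi.single (.inl (.inl a)) 1 := by
  ext ((_ | _) | _) <;> simp [vVec, Pi.single_apply]

theorem wVec_eq_single (a : Idx n) : wVec n a.1 = Pi.single (.inl (.inr a)) 1 := by
  ext ((_ | _) | _) <;> simp [wVec, Pi.single_apply]

theorem vVec_eq_zero {a : ℕ} (h : a ∉ Finset.Icc 1 n) : vVec n a = 0 := by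
  ext ((d | _) | _) <;> simp only [vVec, Pi.zero_apply]
  exact if_neg (ne_of_mem_of_not_mem d.2 h)

theorem wVec_eq_zero {a : ℕ} (h : a ∉ Finset.Icc 1 n) : wVec n a = 0 := by
  ext ((_ | d) | _) <;> simp only [wVec, Pi.zero_apply]
  exact if_neg (ne_of_mem_of_not_mem d.2 h)

theorem wVec_dotProduct_vVec (a b : ℕ) : wVec n a ⬝ᵥ vVec n b = 0 :=
  Finset.sum_eq_zero fun d _ => by rcases d with (_ | _) | _ <;> simp [wVec, vVec]

theorem vVec_dotProduct_vVec_self (a : Idx n) : vVec n a.1 ⬝ᵥ vVec n a.1 = 1 := by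
  simp [vVec_eq_single]

theorem vVec_dotProduct_vVec_of_ne {a b : ℕ} (h : a ≠ b) : vVec n a ⬝ᵥ vVec n b = 0 :=
  Finset.sum_eq_zero fun d _ => by
    rcases d with (d | d) | d <;> simp +contextual [vVec, h.symm]

variable {i : Idx n} {a : ℕ}

theorem isDoublet_vVec (hi : i.1 < n) : IsDoublet i (vVec n i) (vVec n (i + 1)) := by
  rw [vVec_eq_single, vVec_eq_single ⟨i + 1, Finset.mem_Icc.mpr ⟨by omega, hi⟩⟩]
  exact isDoublet_single ⟨hi, rfl, rfl⟩

theorem isDoublet_wVec (hi : i.1 < n) : IsDoublet i (wVec n (i + 1)) (wVec n i) := by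
  rw [wVec_eq_single, wVec_eq_single ⟨i + 1, Finset.mem_Icc.mpr ⟨by omega, hi⟩⟩]
  exact isDoublet_single ⟨hi, rfl, rfl⟩

theorem isDoublet_vVec_pred_wVec_self (hi : i.1 = n) (hia : a + 1 = n) (ha : 1 ≤ a) :
    IsDoublet i (vVec n a) (wVec n i) := by
  rw [wVec_eq_single, vVec_eq_single ⟨a, Finset.mem_Icc.mpr ⟨ha, by omega⟩⟩]
  exact isDoublet_single ⟨hi, .inl ⟨hia, hi⟩⟩

theorem isDoublet_vVec_self_wVec_pred (hi : i.1 = n) (hia : a + 1 = n) (ha : 1 ≤ a) :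
    IsDoublet i (vVec n i) (wVec n a) := by
  rw [vVec_eq_single, wVec_eq_single ⟨a, Finset.mem_Icc.mpr ⟨ha, by omega⟩⟩]
  exact isDoublet_single ⟨hi, .inr ⟨hi, hia⟩⟩

theorem isInvariant_vVec (hai : a ≠ i) (hai' : a ≠ i + 1) (h : i.1 < n ∨ a + 1 < n) :
    IsInvariant i (vVec n a) := by
  by_cases ha : a ∈ Finset.Icc 1 n
  · rw [vVec_eq_single ⟨a, ha⟩]
    refine isInvariant_single fun d => ?_
    rcases d with (d | d) | d <;> simp only [arrow, vecArrow, not_false_eq_true, and_true] <;> omega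
  · rw [vVec_eq_zero ha]
    exact ⟨zero_vecMul _, zero_vecMul _⟩

theorem isInvariant_wVec (hai : a ≠ i) (hai' : a ≠ i + 1) (h : i.1 < n ∨ a + 1 < n) :
    IsInvariant i (wVec n a) := by
  by_cases ha : a ∈ Finset.Icc 1 n
  · rw [wVec_eq_single ⟨a, ha⟩]
    refine isInvariant_single fun d => ?_
    rcases d with (d | d) | d <;>
      simp only [arrow, vecArrow, not_false_eq_true, and_true, true_and] <;> omega
  · rw [wVec_eq_zero ha]
    exact ⟨zero_vecMul _, zero_vecMul _⟩

end CoordinateVectors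

/-- The product `g_a g_{a+1} ⋯ g_n` of the last letters of the word `1, 2, …, n`, for `1 ≤ a`. -/
def suffixProd {n : ℕ} {M : Type*} [Monoid M] (g : Idx n → M) (a : ℕ) : M :=
  (((cycleWord n).drop (a - 1)).map g).prod

section Words

variable {n : ℕ}

theorem suffixProd_eq_mul {M : Type*} [Monoid M] (g : Idx n → M) (i : Idx n) :
    suffixProd g i = g i * suffixProd g (i + 1) := by
  have hi := i.one_le
  have hlen : i.1 - 1 < (cycleWord n).length := by
    have := i.le
    simp only [cycleWord, List.length_ofFn]
    omega
  have hget : (cycleWord n)[i.1 - 1] = i := Subtype.ext (by simp [cycleWord, hi])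
  rw [suffixProd, List.drop_eq_getElem_cons hlen, hget, List.map_cons, List.prod_cons, suffixProd,
    Nat.sub_add_cancel hi, Nat.add_sub_cancel]

theorem le_of_mem_drop_cycleWord {a : ℕ} {i : Idx n} (h : i ∈ (cycleWord n).drop (a - 1)) :
    a ≤ i := by
  obtain ⟨j, hj, rfl⟩ := List.mem_drop_iff_getElem.mp h
  simp only [cycleWord, List.getElem_ofFn]
  omega

variable {g : Idx n → G n} {u : Basis n → ℂ} {a : ℕ}

theorem vecMul_suffixProd_of_fixed (h : ∀ i : Idx n, a ≤ i → u ᵥ* mat (g i) = u) :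
    u ᵥ* mat (suffixProd g a) = u := by
  refine List.prod_induction (fun g => u ᵥ* mat g = u) (fun g g' hg hg' => ?_) (by simp [mat_one])
    fun g' hg' => ?_
  · rw [mat_mul, ← vecMul_vecMul, hg, hg']
  · obtain ⟨i, hi, rfl⟩ := List.mem_map.mp hg'
    exact h i (le_of_mem_drop_cycleWord hi)

theorem suffixProd_mulVec_of_fixed (h : ∀ i : Idx n, a ≤ i → mat (g i) *ᵥ u = u) :
    mat (suffixProd g a) *ᵥ u = u := by
  refine List.prod_induction (fun g => mat g *ᵥ u = u) (fun g g' hg hg' => ?_) (by simp [mat_one])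
    fun g' hg' => ?_
  · rw [mat_mul, ← mulVec_mulVec, hg', hg]
  · obtain ⟨i, hi, rfl⟩ := List.mem_map.mp hg'
    exact h i (le_of_mem_drop_cycleWord hi)

theorem vecMul_suffixProd_one (ha : 1 ≤ a) (han : a ≤ n + 1)
    (h : ∀ i : Idx n, i < a → u ᵥ* mat (g i) = u) :
    u ᵥ* mat (suffixProd g 1) = u ᵥ* mat (suffixProd g a) := by
  induction a, ha using Nat.le_induction with
  | base => rfl
  | succ a ha ih =>
    let i : Idx n := ⟨a, Finset.mem_Icc.mpr ⟨ha, by omega⟩⟩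
    rw [ih (by omega) fun i hi => h i (by omega), suffixProd_eq_mul g i, mat_mul, ← vecMul_vecMul,
      h i (Nat.lt_succ_self a)]

theorem suffixProd_one_mulVec_mem {S : Set (Basis n → ℂ)} (ha : 1 ≤ a) (han : a ≤ n + 1)
    (hS : ∀ i : Idx n, i < a → ∀ x ∈ S, mat (g i) *ᵥ x ∈ S)
    (hu : mat (suffixProd g a) *ᵥ u ∈ S) : mat (suffixProd g 1) *ᵥ u ∈ S := by
  induction a, ha using Nat.le_induction with
  | base => exact hu
  | succ a ha ih =>
    let i : Idx n := ⟨a, Finset.mem_Icc.mpr ⟨ha, by omega⟩⟩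
    refine ih (by omega) (fun i hi => hS i (by omega)) ?_
    rw [suffixProd_eq_mul g i, mat_mul, ← mulVec_mulVec]
    exact hS i (Nat.lt_succ_self a) _ hu

end Words

/-- One cycle `𝐲_1(c_1) 𝐲_2(c_2) ⋯ 𝐲_n(c_n)` of the product `Θ`. -/
noncomputable def cycle (n : ℕ) (c : ℕ → ℂˣ) : G n := suffixProd (fun i => yBold i (c i)) 1

/-- The parameters `c_a` of a cycle, extended by `c_0 = 1`. With this convention the row of
`\overline{a+1}` in a cycle is uniform in `a ≥ 0`, although there is no letter `0`. -/
def param (c : ℕ → ℂˣ) (a : ℕ) : ℂˣ := if a = 0 then 1 else c a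

/-- The row of `\bar a` in the partial cycle `𝐲_a(c_a) ⋯ 𝐲_n(c_n)`. -/
noncomputable def partialCycleRow (n : ℕ) (c : ℕ → ℂˣ) (a : ℕ) : Basis n → ℂ :=
  wVec n a ᵥ* mat (suffixProd (fun i => yBold i (c i)) a)

section CycleRows

variable {n : ℕ} (c : ℕ → ℂˣ)

theorem param_zero : param c 0 = 1 := rfl

theorem param_of_pos {a : ℕ} (ha : 0 < a) : param c a = c a := if_neg ha.ne'

theorem param_smul_wVec_vecMul_cycle {a : ℕ} (ha : a < n) :
    param c a • (wVec n (a + 1) ᵥ* mat (cycle n c)) = partialCycleRow n c (a + 1) := by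
  rcases Nat.eq_zero_or_pos a with rfl | hpos
  · exact one_smul _ _
  · let i : Idx n := ⟨a, Finset.mem_Icc.mpr ⟨hpos, ha.le⟩⟩
    have fixed (j : Idx n) (hj : j.1 < a) :
        wVec n (a + 1) ᵥ* mat (yBold j (c j)) = wVec n (a + 1) :=
      (isInvariant_wVec (by omega) (by omega) (by omega)).vecMul_yBold _
    rw [cycle, vecMul_suffixProd_one hpos (by omega) fixed, suffixProd_eq_mul _ i, mat_mul,
      ← vecMul_vecMul, (isDoublet_wVec (i := i) ha).fst_vecMul_yBold, smul_vecMul,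
      param_of_pos c hpos, Units.smul_def, smul_smul, mul_inv_cancel₀ (c a).ne_zero, one_smul]
    rfl

theorem partialCycleRow_eq_add {a : ℕ} (ha : 1 ≤ a) (han : a + 2 ≤ n) :
    partialCycleRow n c a = (c a : ℂ) • wVec n a + partialCycleRow n c (a + 1) := by
  let i : Idx n := ⟨a, Finset.mem_Icc.mpr ⟨ha, by omega⟩⟩
  have fixed (j : Idx n) (hj : a + 1 ≤ j.1) : wVec n a ᵥ* mat (yBold j (c j)) = wVec n a :=
    (isInvariant_wVec (by omega) (by omega) (by omega)).vecMul_yBold _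
  rw [partialCycleRow, suffixProd_eq_mul _ i, mat_mul, ← vecMul_vecMul,
    (isDoublet_wVec (i := i) (show a < n by omega)).snd_vecMul_yBold, add_vecMul, smul_vecMul,
    vecMul_suffixProd_of_fixed fixed]
  rfl

theorem partialCycleRow_sub_partialCycleRow {a b : ℕ} (ha : 1 ≤ a) (hab : a ≤ b) (hb : b < n) :
    partialCycleRow n c a - partialCycleRow n c b =
      ∑ t ∈ Finset.Ico a b, (c t : ℂ) • wVec n t := by
  induction b, hab using Nat.le_induction with
  | base => simp
  | succ b hab ih =>
    rw [Finset.sum_Ico_succ_top hab, ← ih (by omega),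
      partialCycleRow_eq_add c (ha.trans hab) (by omega)]
    module

theorem partialCycleRow_pred {a : ℕ} (ha : 1 ≤ a) (han : a + 1 = n) :
    partialCycleRow n c a =
      (c a : ℂ) • ((c n : ℂ) • wVec n a + vVec n n) + ((c n : ℂ) • wVec n n + vVec n a) := by
  let i : Idx n := ⟨a, Finset.mem_Icc.mpr ⟨ha, by omega⟩⟩
  let j : Idx n := ⟨a + 1, Finset.mem_Icc.mpr ⟨by omega, by omega⟩⟩
  have suffix_eq : suffixProd (fun i : Idx n => yBold i (c i)) a =
      yBold i (c i) * (yBold j (c j) * 1) := by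
    have drop_eq_nil : (cycleWord n).drop (a + 1) = [] :=
      List.drop_eq_nil_of_le (by simp [cycleWord, han])
    rw [suffixProd_eq_mul _ i, suffixProd_eq_mul _ j, suffixProd, Nat.add_sub_cancel, drop_eq_nil]
    rfl
  have hpred := (isDoublet_vVec_self_wVec_pred (i := j) han han ha).snd_vecMul_yBold (c j)
  have hlast := (isDoublet_vVec_pred_wVec_self (i := j) han han ha).snd_vecMul_yBold (c j)
  rw [partialCycleRow, suffix_eq, mul_one, mat_mul, ← vecMul_vecMul,
    (isDoublet_wVec (i := i) (show a < n by omega)).snd_vecMul_yBold, add_vecMul, smul_vecMul,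
    hpred, show wVec n (i + 1) = wVec n j from rfl, hlast, show j.1 = n from han]

theorem partialCycleRow_dotProduct_vVec_pred {a b : ℕ} (ha : 1 ≤ a) (hab : a ≤ b)
    (hb : b + 1 = n) : partialCycleRow n c a ⬝ᵥ vVec n b = 1 := by
  have hbn : vVec n n ⬝ᵥ vVec n b = 0 := vVec_dotProduct_vVec_of_ne (by omega)
  have hbb := vVec_dotProduct_vVec_self (⟨b, Finset.mem_Icc.mpr ⟨by omega, by omega⟩⟩ : Idx n)
  rw [← sub_add_cancel (partialCycleRow n c a) (partialCycleRow n c b),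
    partialCycleRow_sub_partialCycleRow c ha hab (by omega), partialCycleRow_pred c (by omega) hb]
  simp only [add_dotProduct, sum_dotProduct, smul_dotProduct, wVec_dotProduct_vVec, hbn, hbb,
    smul_zero, Finset.sum_const_zero, add_zero, zero_add]

end CycleRows

/-- The span of `v_1, …, v_m`, the `m`-th step of the standard isotropic flag. -/
noncomputable def flag (n m : ℕ) : Submodule ℂ (Basis n → ℂ) :=
  Submodule.span ℂ (vVec n '' Set.Icc 1 m)

section CycleColumns

variable {n : ℕ}

theorem vVec_mem_flag {a m : ℕ} (ha : 1 ≤ a) (ham : a ≤ m) : vVec n a ∈ flag n m :=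
  Submodule.subset_span ⟨a, ⟨ha, ham⟩, rfl⟩

theorem wVec_dotProduct_of_mem_flag {m : ℕ} (a : ℕ) {u : Basis n → ℂ} (hu : u ∈ flag n m) :
    wVec n a ⬝ᵥ u = 0 := by
  induction hu using Submodule.span_induction with
  | mem u hu => obtain ⟨b, -, rfl⟩ := hu; exact wVec_dotProduct_vVec a b
  | zero => exact dotProduct_zero _
  | add u u' _ _ hu hu' => rw [dotProduct_add, hu, hu', add_zero]
  | smul r u _ hu => rw [dotProduct_smul, hu, smul_zero]

theorem exists_cycle_mulVec_vVec (c : ℕ → ℂˣ) {a : ℕ} (ha : 1 ≤ a) (han : a + 2 ≤ n) :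
    ∃ d : ℂ, mat (cycle n c) *ᵥ vVec n a = d • vVec n a + vVec n (a + 1) := by
  let i : Idx n := ⟨a, Finset.mem_Icc.mpr ⟨ha, by omega⟩⟩
  have fixed (j : Idx n) (hj : a + 1 ≤ j.1) : mat (yBold j (c j)) *ᵥ vVec n a = vVec n a :=
    (isInvariant_vVec (by omega) (by omega) (by omega)).yBold_mulVec _
  refine suffixProd_one_mulVec_mem (S := {x | ∃ d : ℂ, x = d • vVec n a + vVec n (a + 1)}) ha
    (by omega) ?_ ⟨(c a : ℂ)⁻¹, ?_⟩
  · rintro j hj _ ⟨d, rfl⟩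
    have hsucc := (isInvariant_vVec (i := j) (a := a + 1) (by omega) (by omega)
      (by omega)).yBold_mulVec (c j)
    rw [mulVec_add, mulVec_smul, hsucc]
    rcases eq_or_ne a (j + 1) with rfl | hne
    · refine ⟨d * c j, ?_⟩
      rw [(isDoublet_vVec (i := j) (by omega)).yBold_mulVec_snd, smul_smul]
    · exact ⟨d, by rw [(isInvariant_vVec (by omega) hne (by omega)).yBold_mulVec]⟩
  · rw [suffixProd_eq_mul _ i, mat_mul, ← mulVec_mulVec, suffixProd_mulVec_of_fixed fixed,
      (isDoublet_vVec (i := i) (show a < n by omega)).yBold_mulVec_fst]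

theorem cycle_mulVec_vVec_sub_mem_flag (c : ℕ → ℂˣ) {a : ℕ} (ha : 1 ≤ a) (han : a + 2 ≤ n) :
    mat (cycle n c) *ᵥ vVec n a - vVec n (a + 1) ∈ flag n a := by
  obtain ⟨d, hd⟩ := exists_cycle_mulVec_vVec c ha han
  rw [hd, add_sub_cancel_right]
  exact Submodule.smul_mem _ _ (vVec_mem_flag ha le_rfl)

theorem cycle_mulVec_mem_flag (c : ℕ → ℂˣ) {m : ℕ} (hm : m + 2 ≤ n) {u : Basis n → ℂ}
    (hu : u ∈ flag n m) : mat (cycle n c) *ᵥ u ∈ flag n (m + 1) := by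
  suffices flag n m ≤ (flag n (m + 1)).comap (mat (cycle n c)).mulVecLin from this hu
  refine Submodule.span_le.mpr ?_
  rintro _ ⟨a, ⟨ha, ham⟩, rfl⟩
  obtain ⟨d, hd⟩ := exists_cycle_mulVec_vVec (n := n) c ha (by omega)
  change mat (cycle n c) *ᵥ vVec n a ∈ flag n (m + 1)
  rw [hd]
  exact add_mem (Submodule.smul_mem _ _ (vVec_mem_flag ha (ham.trans m.le_succ)))
    (vVec_mem_flag (by omega) (Nat.succ_le_succ ham))

end CycleColumns

/-- The product of the cycles `p, p + 1, …, n - 1` of `Θ n c`, for `1 ≤ p`. -/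
noncomputable def tailΘ (n : ℕ) (c : ℕ → ℕ → ℂˣ) (p : ℕ) : G n :=
  ((List.ofFn fun q : Fin (n - 1) => cycle n (c (q + 1))).drop (p - 1)).prod

section Tail

variable {n : ℕ} (c : ℕ → ℕ → ℂˣ)

theorem tailΘ_one : tailΘ n c 1 = Θ n c := rfl

theorem tailΘ_eq_mul {p : ℕ} (hp : 1 ≤ p) (hpn : p < n) :
    tailΘ n c p = cycle n (c p) * tailΘ n c (p + 1) := by
  have hlen : p - 1 < (List.ofFn fun q : Fin (n - 1) => cycle n (c (q + 1))).length := by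
    rw [List.length_ofFn]
    omega
  rw [tailΘ, List.drop_eq_getElem_cons hlen, List.prod_cons, List.getElem_ofFn,
    Nat.sub_add_cancel hp]
  rfl

theorem tailΘ_self : tailΘ n c n = 1 := by
  rw [tailΘ, List.drop_eq_nil_of_le (by rw [List.length_ofFn]), List.prod_nil]

theorem tailΘ_mulVec_vVec_sub_mem_flag {s t : ℕ} {p : ℕ} (hp : p + t = n) (hs : s + 2 ≤ p) :
    mat (tailΘ n c p) *ᵥ vVec n (s + 1) - vVec n (s + t + 1) ∈ flag n (s + t) := by
  induction t generalizing p with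
  | zero =>
    obtain rfl : p = n := hp
    rw [tailΘ_self, mat_one, one_mulVec, add_zero, sub_self]
    exact zero_mem _
  | succ t ih =>
    have tail_mem := ih (p := p + 1) (by omega) (by omega)
    have rest_mem := cycle_mulVec_mem_flag (c p) (by omega) tail_mem
    have head_mem := cycle_mulVec_vVec_sub_mem_flag (n := n) (a := s + t + 1) (c p) (by omega)
      (by omega)
    rw [tailΘ_eq_mul c (by omega) (by omega), mat_mul, ← mulVec_mulVec]
    rw [mulVec_sub] at rest_mem
    simpa only [sub_add_sub_cancel, add_assoc] using add_mem rest_mem head_mem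

theorem param_smul_wVec_dotProduct_tailΘ {p a : ℕ} (hp : 1 ≤ p) (hpn : p < n)
    (han : a + 2 ≤ n) :
    param (c p) a • (wVec n (a + 1) ⬝ᵥ mat (tailΘ n c p) *ᵥ vVec n p) = 1 := by
  obtain ⟨s, rfl⟩ : ∃ s, p = s + 1 := ⟨p - 1, by omega⟩
  obtain ⟨t, ht⟩ := Nat.exists_eq_add_of_le hpn
  have vanish := wVec_dotProduct_of_mem_flag (a + 1) (cycle_mulVec_mem_flag (c (s + 1)) (by omega)
    (tailΘ_mulVec_vVec_sub_mem_flag (s := s) c ht.symm le_rfl))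
  rw [mulVec_sub, dotProduct_sub, sub_eq_zero] at vanish
  rw [tailΘ_eq_mul c hp hpn, mat_mul, ← mulVec_mulVec, vanish, dotProduct_mulVec,
    ← smul_dotProduct, param_smul_wVec_vecMul_cycle _ (by omega),
    partialCycleRow_dotProduct_vVec_pred _ (by omega) (by omega) (by omega)]

end Tail

theorem det_eq_det_row_sub_of_column_zero_eq_one {R : Type*} [CommRing R] {m : ℕ}
    (A : Matrix (Fin (m + 1)) (Fin (m + 1)) R) (h : ∀ i, A i 0 = 1) :
    det A = (-1) ^ m * det (of fun i j : Fin m => A i.castSucc j.succ - A i.succ j.succ) := by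
  let B : Matrix (Fin (m + 1)) (Fin (m + 1)) R :=
    of (Fin.cons (A 0) fun i => A i.succ - A i.castSucc)
  have det_eq : det A = det B :=
    det_eq_of_forall_row_eq_smul_add_pred 1 (fun _ => rfl) fun i j => by simp [B]
  have minor_eq : B.submatrix Fin.succ Fin.succ =
      -of fun i j : Fin m => A i.castSucc j.succ - A i.succ j.succ := by
    ext i j
    simp [B]
  have corner : B 0 0 = 1 := h 0
  have column (i : Fin m) : B i.succ 0 = 0 := by simp [B, h]
  simp only [det_eq, det_succ_column_zero B, Fin.sum_univ_succ, column, corner, mul_zero, zero_mul,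
    Finset.sum_const_zero, add_zero, Fin.val_zero, pow_zero, mul_one, one_mul]
  exact (congrArg det minor_eq).trans (by rw [det_neg, Fintype.card_fin])

/-- The columns of `v_p, v_{p+1}, …, v_{p+m-1}` in `tailΘ n c p`. -/
noncomputable def tailColumns (n : ℕ) (c : ℕ → ℕ → ℂˣ) (p m : ℕ) : Matrix (Basis n) (Fin m) ℂ :=
  of fun b s => (mat (tailΘ n c p) *ᵥ vVec n (p + s)) b

/-- The signed determinant of the matrix with entries `u_i · (tailΘ n c p) v_{p+s}`, as a function
of the `m` row vectors `u_i`. The sign is that of the reversal of `m` rows. -/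
noncomputable def tailMinor (n : ℕ) (c : ℕ → ℕ → ℂˣ) (p m : ℕ) :
    (Basis n → ℂ) [⋀^Fin m]→ₗ[ℂ] ℂ :=
  (∏ i : Fin m, (-1 : ℂ) ^ i.1) •
    detRowAlternating.compLinearMap (tailColumns n c p m).vecMulLinear

/-- The signed minor of `tailΘ n c p` with rows `\bar 1, …, \bar m, u` and columns
`p, …, p + m`, as a linear form in the last row `u`. -/
noncomputable def hookForm (n : ℕ) (c : ℕ → ℕ → ℂˣ) (p m : ℕ) : (Basis n → ℂ) →ₗ[ℂ] ℂ :=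
  (tailMinor n c p (m + 1)).toMultilinearMap.curryRight fun i : Fin m => wVec n (i + 1)

section Minors

variable {n : ℕ} (c : ℕ → ℕ → ℂˣ) {p m : ℕ}

theorem tailMinor_apply (u : Fin m → Basis n → ℂ) :
    tailMinor n c p m u = (∏ i : Fin m, (-1 : ℂ) ^ i.1) *
      det (of fun i s : Fin m => u i ⬝ᵥ mat (tailΘ n c p) *ᵥ vVec n (p + s)) := rfl

theorem tailMinor_succ (hp : 1 ≤ p) (hpn : p < n) {u : Fin (m + 1) → Basis n → ℂ}
    (hu : ∀ i, u i ⬝ᵥ mat (tailΘ n c p) *ᵥ vVec n p = 1) :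
    tailMinor n c p (m + 1) u =
      tailMinor n c (p + 1) m fun i => (u i.castSucc - u i.succ) ᵥ* mat (cycle n (c p)) := by
  rw [tailMinor_apply, det_eq_det_row_sub_of_column_zero_eq_one _ hu, tailMinor_apply,
    Fin.prod_univ_castSucc, mul_assoc, ← mul_assoc _ ((-1) ^ m)]
  simp only [Fin.val_castSucc, Fin.val_last, ← mul_pow, mul_neg, mul_one, neg_neg, one_pow,
    one_mul, of_apply, ← sub_dotProduct, tailΘ_eq_mul c hp hpn, mat_mul, ← mulVec_mulVec,
    dotProduct_mulVec _ (mat (cycle n (c p))), Fin.val_succ, add_assoc, add_comm 1, sub_vecMul]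

theorem prod_param_mul_tailMinor_succ (hp : 1 ≤ p) (hpn : p < n) {a : Fin (m + 1) → ℕ}
    (ha : ∀ i : Fin m, a i.castSucc ≤ a i.succ) (han : ∀ i, a i + 2 ≤ n) :
    (∏ i, (param (c p) (a i) : ℂ)) * tailMinor n c p (m + 1) (fun i => wVec n (a i + 1)) =
      tailMinor n c (p + 1) m fun i =>
        ∑ t ∈ Finset.Ico (a i.castSucc + 1) (a i.succ + 1), (c p t : ℂ) • wVec n t := by
  rw [← smul_eq_mul, ← AlternatingMap.map_smul_univ, tailMinor_succ c hp hpn]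
  · congr 1 with i : 1
    rw [← partialCycleRow_sub_partialCycleRow (c p) (by omega)
        (Nat.succ_le_succ (ha i)) (by have := han i.succ; omega),
      ← param_smul_wVec_vecMul_cycle (c p) (by have := han i.castSucc; omega),
      ← param_smul_wVec_vecMul_cycle (c p) (by have := han i.succ; omega),
      sub_vecMul, smul_vecMul, smul_vecMul]
    rfl
  · intro i
    rw [smul_dotProduct]
    exact param_smul_wVec_dotProduct_tailΘ c hp hpn (han i)

theorem hookForm_apply (u : Basis n → ℂ) :
    hookForm n c p m u =
      tailMinor n c p (m + 1) (Fin.snoc (fun i : Fin m => wVec n (i + 1)) u) := rfl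

theorem param_mul_hookForm_zero (hp : 1 ≤ p) (hpn : p < n) {a : ℕ} (han : a + 2 ≤ n) :
    param (c p) a * hookForm n c p 0 (wVec n (a + 1)) = 1 := by
  have key := prod_param_mul_tailMinor_succ (m := 0) c hp hpn (a := fun _ => a)
    (fun i => i.elim0) fun _ => han
  rw [tailMinor_apply c (m := 0), det_fin_zero, Fin.prod_univ_zero, Fin.prod_univ_one,
    one_mul] at key
  rw [← key, hookForm_apply]
  congr 2

theorem param_mul_hookForm_succ (hp : 1 ≤ p) (hpn : p < n) {a : ℕ} (hma : m ≤ a)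
    (han : a + 2 ≤ n) :
    param (c p) a * hookForm n c p (m + 1) (wVec n (a + 1)) =
      ∑ t ∈ Finset.Ico (m + 1) (a + 1), (c p t : ℂ) * hookForm n c (p + 1) m (wVec n t) := by
  let idx : Fin (m + 2) → ℕ := Fin.snoc (fun i : Fin (m + 1) => i.1) a
  have idx_le (i : Fin (m + 1)) : idx i.castSucc ≤ idx i.succ := by
    induction i using Fin.lastCases with
    | last => simpa [idx] using hma
    | cast i => simp [idx, ← Fin.castSucc_succ]
  have idx_add_two_le (i : Fin (m + 2)) : idx i + 2 ≤ n := by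
    induction i using Fin.lastCases with
    | last => simpa [idx] using han
    | cast i => simp only [idx, Fin.snoc_castSucc]; omega
  have rows : (fun i => wVec n (idx i + 1)) =
      Fin.snoc (fun i : Fin (m + 1) => wVec n (i + 1)) (wVec n (a + 1)) := by
    ext1 i
    induction i using Fin.lastCases <;> simp [idx]
  have differences : (fun i : Fin (m + 1) =>
        ∑ t ∈ Finset.Ico (idx i.castSucc + 1) (idx i.succ + 1), (c p t : ℂ) • wVec n t) =
      fun i => Fin.snoc (α := fun _ => ℂ) (fun i : Fin m => (c p (i + 1) : ℂ)) 1 i •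
        Fin.snoc (α := fun _ => Basis n → ℂ) (fun i : Fin m => wVec n (i + 1))
          (∑ t ∈ Finset.Ico (m + 1) (a + 1), (c p t : ℂ) • wVec n t) i := by
    ext1 i
    induction i using Fin.lastCases <;> simp [idx, ← Fin.castSucc_succ]
  have params : ∏ i, (param (c p) (idx i) : ℂ) =
      (∏ i : Fin m, (c p (i + 1) : ℂ)) * param (c p) a := by
    rw [Fin.prod_univ_castSucc, Fin.prod_univ_succ]
    simp [idx, param_zero, param_of_pos, -Fin.castSucc_succ]
  have params_ne_zero : ∏ i : Fin m, (c p (i + 1) : ℂ) ≠ 0 :=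
    Finset.prod_ne_zero_iff.mpr fun i _ => (c p (i + 1)).ne_zero
  have key := prod_param_mul_tailMinor_succ c hp hpn idx_le idx_add_two_le
  rw [rows, differences, params, AlternatingMap.map_smul_univ, ← hookForm_apply,
    ← hookForm_apply, Fin.prod_univ_castSucc] at key
  simp only [Fin.snoc_castSucc, Fin.snoc_last, mul_one, map_sum, map_smul, smul_eq_mul,
    mul_assoc] at key
  exact mul_left_cancel₀ params_ne_zero key

theorem hookForm_wVec_succ (hp : 1 ≤ p) (hpn : p + m < n) :
    hookForm n c p m (wVec n (m + 1)) = 1 := by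
  induction m generalizing p with
  | zero => simpa [param_zero] using param_mul_hookForm_zero (a := 0) c hp hpn (by omega)
  | succ m ih =>
    have key := param_mul_hookForm_succ (n := n) (m := m) (a := m + 1) c hp (by omega)
      (Nat.le_succ m) (by omega)
    rw [Nat.Ico_succ_singleton, Finset.sum_singleton, ih (by omega) (by omega),
      param_of_pos _ m.succ_pos] at key
    exact mul_left_cancel₀ (c p (m + 1)).ne_zero key

theorem hookForm_wVec_add_two (hp : 1 ≤ p) (hpn : p + m + 2 ≤ n) :
    hookForm n c p m (wVec n (m + 2)) =
      ∑ j ∈ Finset.Ico p (p + m), (c j (p + m - j) : ℂ) / c j (p + m - j + 1) +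
        1 / c (p + m) 1 := by
  induction m generalizing p with
  | zero =>
    have key := param_mul_hookForm_zero (a := 1) c hp (by omega) (show 1 + 2 ≤ n by omega)
    rw [param_of_pos _ one_pos] at key
    simpa using eq_one_div_of_mul_eq_one_right key
  | succ m ih =>
    have key := param_mul_hookForm_succ (n := n) (m := m) (a := m + 2) c hp (by omega) (by omega)
      (by omega)
    rw [Finset.sum_Ico_succ_top (by omega), Nat.Ico_succ_singleton, Finset.sum_singleton,
      hookForm_wVec_succ c (by omega) (by omega), param_of_pos _ (by omega),
      ih (p := p + 1) (by omega) (by omega), mul_one] at key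
    rw [Finset.sum_eq_sum_Ico_succ_bot (by omega), show p + (m + 1) - p = m + 1 by omega,
      show p + (m + 1) = p + 1 + m by omega]
    have hc : (c p (m + 2) : ℂ) ≠ 0 := (c p (m + 2)).ne_zero
    apply mul_left_cancel₀ hc
    rw [key]
    field_simp
    ring

end Minors

/-- The product `\bar s_1 \bar s_2 ⋯ \bar s_n`, whose power `w₀Bar n` represents `w₀`. -/
noncomputable def coxeterBar (n : ℕ) : G n := suffixProd sBar 1

section LongestElement

variable {n : ℕ}

theorem w₀Bar_eq_coxeterBar_pow : w₀Bar n = coxeterBar n ^ (n - 1) := rfl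

theorem wVec_one_vecMul_coxeterBar_eq {a : ℕ} (ha : 1 ≤ a) (han : a ≤ n) :
    wVec n 1 ᵥ* mat (coxeterBar n) = wVec n a ᵥ* mat (suffixProd sBar a) := by
  induction a, ha using Nat.le_induction with
  | base => rfl
  | succ a ha ih =>
    let i : Idx n := ⟨a, Finset.mem_Icc.mpr ⟨ha, by omega⟩⟩
    rw [ih (by omega), suffixProd_eq_mul sBar i, mat_mul, ← vecMul_vecMul,
      (isDoublet_wVec (i := i) han).snd_vecMul_sBar]

theorem wVec_one_vecMul_coxeterBar (hn : 2 ≤ n) :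
    wVec n 1 ᵥ* mat (coxeterBar n) = vVec n (n - 1) := by
  let i : Idx n := ⟨n, Finset.mem_Icc.mpr ⟨by omega, le_rfl⟩⟩
  have doublet : IsDoublet i (vVec n (n - 1)) (wVec n n) :=
    isDoublet_vVec_pred_wVec_self rfl (by omega) (by omega)
  rw [wVec_one_vecMul_coxeterBar_eq (by omega) le_rfl, suffixProd_eq_mul sBar i, mat_mul,
    ← vecMul_vecMul, doublet.snd_vecMul_sBar]
  exact vecMul_suffixProd_of_fixed fun j hj => absurd (hj.trans j.le) (Nat.not_succ_le_self n)

theorem wVec_succ_vecMul_coxeterBar {a : ℕ} (ha : 1 ≤ a) (han : a + 2 ≤ n) :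
    wVec n (a + 1) ᵥ* mat (coxeterBar n) = -wVec n a := by
  let i : Idx n := ⟨a, Finset.mem_Icc.mpr ⟨ha, by omega⟩⟩
  have fixed_before (j : Idx n) (hj : j.1 < a) : wVec n (a + 1) ᵥ* mat (sBar j) = wVec n (a + 1) :=
    (isInvariant_wVec (by omega) (by omega) (by omega)).vecMul_sBar
  have fixed_after (j : Idx n) (hj : a + 1 ≤ j.1) : (-wVec n a) ᵥ* mat (sBar j) = -wVec n a := by
    rw [neg_vecMul, (isInvariant_wVec (by omega) (by omega) (by omega)).vecMul_sBar]
  rw [coxeterBar, vecMul_suffixProd_one ha (by omega) fixed_before, suffixProd_eq_mul sBar i,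
    mat_mul, ← vecMul_vecMul, (isDoublet_wVec (i := i) (show a < n by omega)).fst_vecMul_sBar,
    vecMul_suffixProd_of_fixed fixed_after]

theorem vVec_succ_vecMul_coxeterBar {a : ℕ} (ha : 1 ≤ a) (han : a + 2 ≤ n) :
    vVec n (a + 1) ᵥ* mat (coxeterBar n) = vVec n a := by
  let i : Idx n := ⟨a, Finset.mem_Icc.mpr ⟨ha, by omega⟩⟩
  have fixed_before (j : Idx n) (hj : j.1 < a) : vVec n (a + 1) ᵥ* mat (sBar j) = vVec n (a + 1) :=
    (isInvariant_vVec (by omega) (by omega) (by omega)).vecMul_sBar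
  have fixed_after (j : Idx n) (hj : a + 1 ≤ j.1) : vVec n a ᵥ* mat (sBar j) = vVec n a :=
    (isInvariant_vVec (by omega) (by omega) (by omega)).vecMul_sBar
  rw [coxeterBar, vecMul_suffixProd_one ha (by omega) fixed_before, suffixProd_eq_mul sBar i,
    mat_mul, ← vecMul_vecMul, (isDoublet_vVec (i := i) (show a < n by omega)).snd_vecMul_sBar,
    vecMul_suffixProd_of_fixed fixed_after]

theorem wVec_succ_vecMul_coxeterBar_pow {t : ℕ} (ht : t + 2 ≤ n) :
    wVec n (t + 1) ᵥ* mat (coxeterBar n ^ (t + 1)) = (-1 : ℂ) ^ t • vVec n (n - 1) := by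
  induction t with
  | zero => simpa using wVec_one_vecMul_coxeterBar ht
  | succ t ih =>
    rw [pow_succ', mat_mul, ← vecMul_vecMul, wVec_succ_vecMul_coxeterBar (by omega) (by omega),
      neg_vecMul, ih (by omega), pow_succ, mul_neg_one, neg_smul]

theorem vVec_add_vecMul_coxeterBar_pow {a t : ℕ} (ha : 1 ≤ a) (hat : a + t + 1 ≤ n) :
    vVec n (a + t) ᵥ* mat (coxeterBar n ^ t) = vVec n a := by
  induction t with
  | zero => simp [mat_one]
  | succ t ih =>
    rw [pow_succ', mat_mul, ← vecMul_vecMul, ← add_assoc,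
      vVec_succ_vecMul_coxeterBar (by omega) (by omega), ih (by omega)]

theorem wVec_succ_vecMul_w₀Bar {r : ℕ} (hr : r + 2 ≤ n) :
    wVec n (r + 1) ᵥ* mat (w₀Bar n) = (-1 : ℂ) ^ r • vVec n (r + 1) := by
  obtain ⟨t, rfl⟩ := Nat.exists_eq_add_of_le hr
  have split : r + 2 + t - 1 = r + 1 + t := by omega
  rw [w₀Bar_eq_coxeterBar_pow, split, pow_add, mat_mul, ← vecMul_vecMul,
    wVec_succ_vecMul_coxeterBar_pow hr, smul_vecMul, split,
    vVec_add_vecMul_coxeterBar_pow (by omega) (by omega)]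

theorem vVec_succ_vecMul_w₀Bar_inv {r : ℕ} (hr : r + 2 ≤ n) :
    vVec n (r + 1) ᵥ* mat (w₀Bar n)⁻¹ = (-1 : ℂ) ^ r • wVec n (r + 1) := by
  have h := congrArg (· ᵥ* mat (w₀Bar n)⁻¹) (wVec_succ_vecMul_w₀Bar hr)
  simp only [vecMul_vecMul, ← mat_mul, mul_inv_cancel, mat_one, vecMul_one, smul_vecMul] at h
  rw [h, smul_smul, ← mul_pow, neg_one_mul, neg_neg, one_pow, one_smul]

theorem vVec_vecMul_sBar_mul_w₀Bar_inv_of_lt {k : Idx n} (hk : k.1 + 2 ≤ n) {r : ℕ}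
    (hr : r + 1 < k.1) :
    vVec n (r + 1) ᵥ* mat (sBar k * (w₀Bar n)⁻¹) = (-1 : ℂ) ^ r • wVec n (r + 1) := by
  rw [mat_mul, ← vecMul_vecMul, (isInvariant_vVec (by omega) (by omega) (by omega)).vecMul_sBar,
    vVec_succ_vecMul_w₀Bar_inv (by omega)]

theorem vVec_vecMul_sBar_mul_w₀Bar_inv_self {k : Idx n} (hk : k.1 + 2 ≤ n) {r : ℕ}
    (hr : r + 1 = k.1) :
    vVec n (r + 1) ᵥ* mat (sBar k * (w₀Bar n)⁻¹) = (-1 : ℂ) ^ r • wVec n (r + 2) := by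
  rw [mat_mul, ← vecMul_vecMul, hr, (isDoublet_vVec (by omega)).fst_vecMul_sBar, neg_vecMul,
    vVec_succ_vecMul_w₀Bar_inv hk, ← hr, pow_succ, mul_neg_one, neg_smul, neg_neg]

end LongestElement

section GeneralizedMinor

variable {n : ℕ}

theorem mat_apply_vVec (g : G n) (a b : Idx n) :
    mat g (.inl (.inl a)) (.inl (.inl b)) = vVec n a.1 ⬝ᵥ mat g *ᵥ vVec n b.1 := by
  classical
  rw [vVec_eq_single, vVec_eq_single, mulVec_single_one, single_one_dotProduct, col_apply]

/-- The enumeration of `{1, …, k}`, which indexes the rows and columns of `principalMinor k`. -/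
def headEquiv (k : Idx n) : Fin k.1 ≃ {a : Idx n // a.1 ≤ k.1} where
  toFun r := ⟨⟨r.1 + 1, Finset.mem_Icc.mpr ⟨by omega, by have := k.le; omega⟩⟩, r.2⟩
  invFun a := ⟨a.1.1 - 1, by have := a.1.one_le; have := a.2; omega⟩
  left_inv r := by simp
  right_inv a := by
    have := a.1.one_le
    exact Subtype.ext (Subtype.ext (by simp only; omega))

theorem principalMinor_eq_det (k : Idx n) (g : G n) :
    principalMinor k g =
      det (of fun r s : Fin k.1 => vVec n (r.1 + 1) ⬝ᵥ mat g *ᵥ vVec n (s.1 + 1)) := by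
  rw [principalMinor, ← det_submatrix_equiv_self (headEquiv k)]
  congr 1
  ext r s
  exact mat_apply_vVec g _ _

theorem generalizedMinor_w₀sBar_one (k : Idx n) (g : G n) :
    generalizedMinor k (w₀sBar k) 1 g = principalMinor k (sBar k * (w₀Bar n)⁻¹ * g) := by
  rw [generalizedMinor, w₀sBar, _root_.mul_inv_rev, inv_inv, mul_one]

theorem generalizedMinor_Θ_eq_hookForm (c : ℕ → ℕ → ℂˣ) {m : ℕ} {k : Idx n} (hmk : m + 1 = k.1)
    (hk : k.1 + 2 ≤ n) :
    generalizedMinor k (w₀sBar k) 1 (Θ n c) = hookForm n c 1 m (wVec n (m + 2)) := by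
  obtain ⟨_, hk_mem⟩ := k
  obtain rfl : m + 1 = _ := hmk
  have row (r : Fin (m + 1)) :
      vVec n (r + 1) ᵥ* mat (sBar ⟨m + 1, hk_mem⟩ * (w₀Bar n)⁻¹) = (-1 : ℂ) ^ r.1 •
        Fin.snoc (α := fun _ => Basis n → ℂ) (fun i : Fin m => wVec n (i + 1))
          (wVec n (m + 2)) r := by
    induction r using Fin.lastCases with
    | last => rw [Fin.snoc_last]; exact vVec_vecMul_sBar_mul_w₀Bar_inv_self hk rfl
    | cast i =>
      rw [Fin.snoc_castSucc]
      exact vVec_vecMul_sBar_mul_w₀Bar_inv_of_lt hk (Nat.succ_lt_succ i.2)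
  rw [generalizedMinor_w₀sBar_one, principalMinor_eq_det, hookForm_apply, tailMinor_apply,
    ← det_mul_column, tailΘ_one]
  congr 1
  ext r s
  rw [of_apply, of_apply, of_apply, mat_mul _ (Θ n c), ← mulVec_mulVec, dotProduct_mulVec, row,
    smul_dotProduct, smul_eq_mul, add_comm 1]

end GeneralizedMinor

end TypeD

theorem mainTheorem10 (n k : ℕ) (hk : 1 ≤ k) (hkn : k ≤ n - 2) (c : ℕ → ℕ → ℂˣ) :
    TypeD.generalizedMinor (⟨k, Finset.mem_Icc.mpr ⟨hk, by omega⟩⟩ : TypeD.Idx n)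
        (TypeD.w₀sBar ⟨k, Finset.mem_Icc.mpr ⟨hk, by omega⟩⟩) 1 (TypeD.Θ n c) =
      1 / (c k 1 : ℂ) +
        ∑ j ∈ Finset.Icc 1 (k - 1), (c j (k - j) : ℂ) / (c j (k - j + 1) : ℂ) := by
  obtain ⟨m, rfl⟩ := Nat.exists_eq_add_of_le' hk
  rw [TypeD.generalizedMinor_Θ_eq_hookForm c rfl (by simp only; omega),
    TypeD.hookForm_wVec_add_two c le_rfl (by omega), add_comm, add_comm 1 m]
  rfl
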